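/- Let $(\Omega,\mathcal F)$ be a measurable space with a sequence of real random variables $X_1,X_2,\dots$, let $S_k:=\sum_{i=1}^k X_i$, and let $\overline{\mathcal P}$ be the family of all probability measures $\mathsf P$ on $(\Omega,\mathcal F)$ under which $(X_n)_{n\ge1}$ is i.i.d., integrable, with expected value zero. Let $q\in[1,2)$, and for $\mathsf P\in\overline{\mathcal P}$, $m\in\mathbb N=\{1,2,\dots\}$ and $\varepsilon>0$ define $$P_m^{(\varepsilon)}:=\mathsf P\Big[\sup_{k\ge m}\big|k^{-1/q}S_k\big|\ge\varepsilon\Big].$$ Then for every $\mathsf P\in\overline{\mathcal P}$ and every $\varepsilon>0$, $$\sum_{m=1}^\infty\frac{P_m^{(\varepsilon)}}{m}\le 1+\frac{c_q}{e\,\log\!\big(2^{1/q-1/2}\big)}+\frac{2603\;\mathsf E_{\mathsf P}\big[|X_1|^q\log\big(38|X_1|^q/\varepsilon^q+1\big)\big]}{(2-q)\,(\varepsilon^2\wedge1)},\qquad c_q:=\frac{2}{2-q},$$ where $\log$ is the natural logarithm and the right-hand side may be $+\infty$. In particular, if $\mathcal P\subset\overline{\mathcal P}$ is a collection of probability measures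 for which $$\sup_{\mathsf P\in\mathcal P}\mathsf E_{\mathsf P}\big[|X_1|^q\log(|X_1|^q+1)\big]<\infty,$$ then $\sup_{\mathsf P\in\mathcal P}\sum_{m=1}^\infty P_m^{(\varepsilon)}/m<\infty$ for every $\varepsilon>0$. -/

import Mathlib

open MeasureTheory ProbabilityTheory
open scoped ENNReal

noncomputable section

namespace BaumKatz

/-- The family of all probability measures under which the sequence of random variables is
independent and identically distributed, integrable, with expected value zero.
The sequence `X₁, X₂, X₃, …` is written `X 0, X 1, X 2, …`. -/
def centeredIIDLaws {Ω : Type*} [MeasurableSpace Ω] (X : ℕ → Ω → ℝ) : Set (Measure Ω) :=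
  {P | IsProbabilityMeasure P ∧ iIndepFun X P ∧ (∀ n, IdentDistrib (X n) (X 0) P P) ∧
    (∀ n, Integrable (X n) P) ∧ ∀ n, ∫ ω, X n ω ∂P = 0}

/-- `S_k = X₁ + ⋯ + X_k`, the sum of the first `k` variables. -/
def partialSum {Ω : Type*} (X : ℕ → Ω → ℝ) (k : ℕ) (ω : Ω) : ℝ :=
  ∑ i ∈ Finset.range k, X i ω

/-- `P [sup_{k ≥ m} |k^{-1/q} S_k| ≥ ε]`; the supremum is taken in `[0, ∞]`, so that it has its
usual meaning also where it is infinite. -/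
def tailProb {Ω : Type*} [MeasurableSpace Ω] (X : ℕ → Ω → ℝ) (P : Measure Ω)
    (q ε : ℝ) (m : ℕ) : ℝ≥0∞ :=
  P {ω | ENNReal.ofReal ε ≤
    ⨆ k : ℕ, ⨆ _ : m ≤ k, ENNReal.ofReal |(k : ℝ) ^ (-(1 / q)) * partialSum X k ω|}

/-- The series `∑_{m ≥ 1} P_m / m`, with value in `[0, ∞]`. -/
def tailSeries {Ω : Type*} [MeasurableSpace Ω] (X : ℕ → Ω → ℝ) (P : Measure Ω)
    (q ε : ℝ) : ℝ≥0∞ :=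
  ∑' m : ℕ+, tailProb X P q ε (m : ℕ) / ((m : ℕ) : ℝ≥0∞)

/-- `E_P [|X₁|^q log (a |X₁|^q + 1)]`, with value in `[0, ∞]`; the integrand is nonnegative
for `a ≥ 0`. -/
def logMoment {Ω : Type*} [MeasurableSpace Ω] (X : ℕ → Ω → ℝ) (P : Measure Ω)
    (q a : ℝ) : ℝ≥0∞ :=
  ∫⁻ ω, ENNReal.ofReal (|X 0 ω| ^ q * Real.log (a * |X 0 ω| ^ q + 1)) ∂P

/-- The constant `c_q = 2 / (2 - q)`. -/
def cConst (q : ℝ) : ℝ := 2 / (2 - q)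

end BaumKatz

end

/-! Rescaling reduces to ε = 1. Put Z = |X₁|^q and b = 2/q - 1, so that 1 + 1/b = c_q. For fixed m,
the k-th variable is truncated where its q-th power exceeds max(k, m). The chance that any
truncation acts is at most T = E[Z; Z > m]. If T ≤ 1/8, the means of the truncated variables shift
the normalized sums by at most 1/4; if T > 1/8, then 9T ≥ 1 bounds the probability trivially. The
recentered truncated sums obey `hajek_renyi` with weights max(k, m)^(-2/q). This yields
`tailProb_one_le`: P_m ≤ 9 E[Z; Z > m] + 4 c_q E[Z^(1+b) max(Z, m)^(-b)].

Now divide by m and sum inside the expectation. The indices m ≤ Z give a harmonic sum, hence Z(1 +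
log Z). The indices m > Z give a tail of ∑ m^(-1-b), which costs a second factor c_q. To stay linear
in c_q, the terms with m ≤ e^l are bounded by 1/m, at cost 1 + l, where b l ≥ c_q/2; the other terms
then carry a decay that absorbs one c_q (`mul_rpow_mul_max_rpow_le`). A second l pays for small Z
(`add_le_of_log`), and 2l is the explicit logarithmic constant of the bound.

The uniform statement follows because log(aZ + 1) is controlled by log(Z + 1) with constants
depending on a alone. -/

namespace BaumKatz

variable {Ω : Type*} [MeasurableSpace Ω]

/-! ### Hájek–Rényi inequality via a weighted submartingale. -/

/-- The process `∑_{i ≤ n} c_i (S_{i+1}² - S_i²)`, which dominates `c_n S_{n+1}²`. -/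
def weightedSquares (ξ : ℕ → Ω → ℝ) (c : ℕ → ℝ) (n : ℕ) (ω : Ω) : ℝ :=
  ∑ i ∈ Finset.range (n + 1), c i * (partialSum ξ (i + 1) ω ^ 2 - partialSum ξ i ω ^ 2)

theorem partialSum_succ {Ω : Type*} [MeasurableSpace Ω] (ξ : ℕ → Ω → ℝ)
    (n : ℕ) (ω : Ω) :
    partialSum ξ (n + 1) ω = partialSum ξ n ω + ξ n ω := Finset.sum_range_succ _ _

theorem weightedSquares_succ (ξ : ℕ → Ω → ℝ) (c : ℕ → ℝ) (n : ℕ) (ω : Ω) :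
    weightedSquares ξ c (n + 1) ω = weightedSquares ξ c n ω +
      c (n + 1) * (2 * (partialSum ξ (n + 1) ω * ξ (n + 1) ω) + ξ (n + 1) ω ^ 2) := by
  rw [weightedSquares, Finset.sum_range_succ, weightedSquares, partialSum_succ ξ (n + 1)]
  ring

theorem weightedSquares_zero {Ω : Type*} [MeasurableSpace Ω] (ξ : ℕ → Ω → ℝ)
    (c : ℕ → ℝ) (ω : Ω) :
    weightedSquares ξ c 0 ω = c 0 * ξ 0 ω ^ 2 := by
  simp [weightedSquares, partialSum]

/-- Summation by parts: the difference of the two sides is the sum over i < n of (c_i - c_{i+1})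
S_{i+1}², which is nonnegative. -/
theorem le_weightedSquares (ξ : ℕ → Ω → ℝ) {c : ℕ → ℝ} (hc : Antitone c) (n : ℕ) (ω : Ω) :
    c n * partialSum ξ (n + 1) ω ^ 2 ≤ weightedSquares ξ c n ω := by
  induction n with
  | zero => simp [weightedSquares, partialSum]
  | succ n ih =>
    rw [weightedSquares_succ, partialSum_succ ξ (n + 1)]
    have := mul_le_mul_of_nonneg_right (hc n.le_succ) (sq_nonneg (partialSum ξ (n + 1) ω))
    simp only [Nat.succ_eq_add_one] at this
    nlinarith

theorem memLp_partialSum {ξ : ℕ → Ω → ℝ} {P : Measure Ω} (h2 : ∀ i, MemLp (ξ i) 2 P) (n : ℕ) :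
    MemLp (partialSum ξ n) 2 P := by
  unfold partialSum
  exact memLp_finsetSum _ fun i _ => h2 i

theorem stronglyMeasurable_natural_partialSum {ξ : ℕ → Ω → ℝ}
    (hξ : ∀ i, StronglyMeasurable (ξ i)) (n : ℕ) :
    StronglyMeasurable[Filtration.natural ξ hξ n] (partialSum ξ (n + 1)) := by
  unfold partialSum
  refine Finset.stronglyMeasurable_fun_sum _ fun i hi => ?_
  exact (Filtration.stronglyAdapted_natural hξ i).mono
    ((Filtration.natural ξ hξ).mono (Nat.lt_succ_iff.1 (Finset.mem_range.1 hi)))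

theorem stronglyMeasurable_natural_weightedSquares {ξ : ℕ → Ω → ℝ} (c : ℕ → ℝ)
    (hξ : ∀ i, StronglyMeasurable (ξ i)) (n : ℕ) :
    StronglyMeasurable[Filtration.natural ξ hξ n] (weightedSquares ξ c n) := by
  induction n with
  | zero =>
    have : weightedSquares ξ c 0 = fun ω => c 0 * ξ 0 ω ^ 2 :=
      funext fun ω => weightedSquares_zero ξ c ω
    rw [this]
    exact ((Filtration.stronglyAdapted_natural hξ 0).pow 2).const_mul _
  | succ n ih =>
    have : weightedSquares ξ c (n + 1) = fun ω => weightedSquares ξ c n ω +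
      c (n + 1) * (2 * (partialSum ξ (n + 1) ω * ξ (n + 1) ω) + ξ (n + 1) ω ^ 2) :=
      funext fun ω => weightedSquares_succ ξ c n ω
    rw [this]
    have hle := (Filtration.natural ξ hξ).mono n.le_succ
    have h0 := Filtration.stronglyAdapted_natural hξ (n + 1)
    exact (ih.mono hle).add (((((stronglyMeasurable_natural_partialSum hξ n).mono hle).mul
      h0).const_mul _ |>.add (h0.pow 2)).const_mul _)

theorem integrable_partialSum_mul {ξ : ℕ → Ω → ℝ} {P : Measure Ω}
    (h2 : ∀ i, MemLp (ξ i) 2 P) (n : ℕ) :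
    Integrable (fun ω => partialSum ξ n ω * ξ n ω) P :=
  (memLp_partialSum h2 n).integrable_mul (h2 n)

theorem integrable_weightedSquares {ξ : ℕ → Ω → ℝ} {P : Measure Ω} (c : ℕ → ℝ)
    (h2 : ∀ i, MemLp (ξ i) 2 P) (n : ℕ) : Integrable (weightedSquares ξ c n) P := by
  unfold weightedSquares
  exact integrable_finsetSum _ fun i _ =>
    (((memLp_partialSum h2 (i + 1)).integrable_sq).sub
      ((memLp_partialSum h2 i).integrable_sq)).const_mul _

/-- A square-integrable centered variable is orthogonal to the preceding partial sum on every
event of the past. -/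
theorem setIntegral_partialSum_mul_eq_zero {ξ : ℕ → Ω → ℝ} {P : Measure Ω}
    [IsProbabilityMeasure P] (hξ : ∀ i, StronglyMeasurable (ξ i)) (hind : iIndepFun ξ P)
    (h0 : ∀ i, ∫ ω, ξ i ω ∂P = 0) (n : ℕ) {s : Set Ω}
    (hs : MeasurableSet[Filtration.natural ξ hξ n] s) :
    ∫ ω in s, partialSum ξ (n + 1) ω * ξ (n + 1) ω ∂P = 0 := by
  have hle := (Filtration.natural ξ hξ).le n
  have hI : Indep (Filtration.natural ξ hξ n) (MeasurableSpace.comap (ξ (n + 1)) inferInstance) P :=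
    (hind.indep_comap_natural_of_lt hξ n.lt_succ_self).symm
  have hm : Measurable[Filtration.natural ξ hξ n] (s.indicator (partialSum ξ (n + 1))) :=
    (stronglyMeasurable_natural_partialSum hξ n).measurable.indicator hs
  have hIF : IndepFun (s.indicator (partialSum ξ (n + 1))) (ξ (n + 1)) P := by
    rw [IndepFun_iff_Indep]
    exact indep_of_indep_of_le_left hI hm.comap_le
  rw [← integral_indicator (hle s hs)]
  have : (s.indicator fun ω => partialSum ξ (n + 1) ω * ξ (n + 1) ω) =
      fun ω => s.indicator (partialSum ξ (n + 1)) ω * ξ (n + 1) ω := by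
    ext ω
    by_cases h : ω ∈ s <;> simp [h]
  rw [this, hIF.integral_fun_mul_eq_mul_integral (hm.mono hle le_rfl).aestronglyMeasurable
    (hξ _).aestronglyMeasurable, h0, mul_zero]

theorem setIntegral_weightedSquares_succ {ξ : ℕ → Ω → ℝ} {P : Measure Ω}
    [IsProbabilityMeasure P] (hξ : ∀ i, StronglyMeasurable (ξ i)) (hind : iIndepFun ξ P)
    (h2 : ∀ i, MemLp (ξ i) 2 P) (h0 : ∀ i, ∫ ω, ξ i ω ∂P = 0) (c : ℕ → ℝ) (n : ℕ) {s : Set Ω}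
    (hs : MeasurableSet[Filtration.natural ξ hξ n] s) :
    ∫ ω in s, weightedSquares ξ c (n + 1) ω ∂P =
      ∫ ω in s, weightedSquares ξ c n ω ∂P + c (n + 1) * ∫ ω in s, ξ (n + 1) ω ^ 2 ∂P := by
  have i1 : IntegrableOn (fun ω => 2 * (partialSum ξ (n + 1) ω * ξ (n + 1) ω)) s P :=
    ((integrable_partialSum_mul h2 (n + 1)).const_mul 2).integrableOn
  have i2 : IntegrableOn (fun ω => ξ (n + 1) ω ^ 2) s P :=
    (h2 (n + 1)).integrable_sq.integrableOn
  have i3 : IntegrableOn (fun ω => c (n + 1) *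
      (2 * (partialSum ξ (n + 1) ω * ξ (n + 1) ω) + ξ (n + 1) ω ^ 2)) s P :=
    Integrable.const_mul (i1.add i2) _
  simp only [weightedSquares_succ]
  rw [integral_add (integrable_weightedSquares c h2 n).integrableOn i3,
    integral_const_mul, integral_add i1 i2, integral_const_mul,
    setIntegral_partialSum_mul_eq_zero hξ hind h0 n hs, mul_zero, zero_add]

/-- The increment is c_{n+1} (2 S ξ + ξ²); the cross term integrates to zero over past events and a
nonnegative term remains. -/
theorem submartingale_weightedSquares {ξ : ℕ → Ω → ℝ} {P : Measure Ω}
    [IsProbabilityMeasure P] (hξ : ∀ i, StronglyMeasurable (ξ i)) (hind : iIndepFun ξ P)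
    (h2 : ∀ i, MemLp (ξ i) 2 P) (h0 : ∀ i, ∫ ω, ξ i ω ∂P = 0) {c : ℕ → ℝ} (hc : ∀ i, 0 ≤ c i) :
    Submartingale (weightedSquares ξ c) (Filtration.natural ξ hξ) P := by
  refine submartingale_of_setIntegral_le_succ
    (stronglyMeasurable_natural_weightedSquares c hξ) (integrable_weightedSquares c h2)
    fun n s hs => ?_
  rw [setIntegral_weightedSquares_succ hξ hind h2 h0 c n hs]
  exact le_add_of_nonneg_right (mul_nonneg (hc _) (integral_nonneg fun ω => sq_nonneg _))

theorem integral_weightedSquares {ξ : ℕ → Ω → ℝ} {P : Measure Ω}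
    [IsProbabilityMeasure P] (hξ : ∀ i, StronglyMeasurable (ξ i)) (hind : iIndepFun ξ P)
    (h2 : ∀ i, MemLp (ξ i) 2 P) (h0 : ∀ i, ∫ ω, ξ i ω ∂P = 0) (c : ℕ → ℝ) (n : ℕ) :
    ∫ ω, weightedSquares ξ c n ω ∂P =
      ∑ i ∈ Finset.range (n + 1), c i * ∫ ω, ξ i ω ^ 2 ∂P := by
  induction n with
  | zero => simp [weightedSquares_zero, integral_const_mul]
  | succ n ih =>
    have := setIntegral_weightedSquares_succ hξ hind h2 h0 c n (s := Set.univ) MeasurableSet.univ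
    simp only [Measure.restrict_univ] at this
    rw [Finset.sum_range_succ, ← ih, this]

/-- The Hájek–Rényi maximal inequality, for infinitely many partial sums. -/
theorem hajek_renyi {ξ : ℕ → Ω → ℝ} {P : Measure Ω}
    [IsProbabilityMeasure P] (hξ : ∀ i, Measurable (ξ i)) (hind : iIndepFun ξ P)
    (h2 : ∀ i, MemLp (ξ i) 2 P) (h0 : ∀ i, ∫ ω, ξ i ω ∂P = 0) {c : ℕ → ℝ} (hc : ∀ i, 0 ≤ c i)
    (hanti : Antitone c) (t : NNReal) :
    t * P {ω | ∃ n, (t : ℝ) ≤ c n * partialSum ξ (n + 1) ω ^ 2} ≤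
      ∑' i, ENNReal.ofReal (c i * ∫ ω, ξ i ω ^ 2 ∂P) := by
  have hξ' : ∀ i, StronglyMeasurable (ξ i) := fun i => (hξ i).stronglyMeasurable
  have hsub := submartingale_weightedSquares hξ' hind h2 h0 hc
  have hnn : 0 ≤ weightedSquares ξ c := fun n ω =>
    (mul_nonneg (hc n) (sq_nonneg _)).trans (le_weightedSquares ξ hanti n ω)
  have hmono : Monotone fun n => {ω | ∃ k ≤ n, (t : ℝ) ≤ c k * partialSum ξ (k + 1) ω ^ 2} :=
    fun a b hab ω ⟨k, hk, h⟩ => ⟨k, hk.trans hab, h⟩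
  have hU : {ω | ∃ n, (t : ℝ) ≤ c n * partialSum ξ (n + 1) ω ^ 2} =
      ⋃ n, {ω | ∃ k ≤ n, (t : ℝ) ≤ c k * partialSum ξ (k + 1) ω ^ 2} := by
    ext ω
    simp only [Set.mem_ofPred_eq, Set.mem_iUnion]
    exact ⟨fun ⟨n, h⟩ => ⟨n, n, le_rfl, h⟩, fun ⟨_, k, _, h⟩ => ⟨k, h⟩⟩
  -- Continuity from below reduces the claim to finite horizons, where Doob's maximal inequality
  -- applies.
  rw [hU, hmono.measure_iUnion, ENNReal.mul_iSup]
  refine iSup_le fun n => ?_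
  calc (t : ℝ≥0∞) * P {ω | ∃ k ≤ n, (t : ℝ) ≤ c k * partialSum ξ (k + 1) ω ^ 2}
      ≤ t * P {ω | (t : ℝ) ≤ (Finset.range (n + 1)).sup' Finset.nonempty_range_add_one
          fun k => weightedSquares ξ c k ω} := by
        gcongr with ω
        rintro ⟨k, hk, h⟩
        exact (h.trans (le_weightedSquares ξ hanti k ω)).trans
          (Finset.le_sup' (fun k => weightedSquares ξ c k ω)
            (Finset.mem_range.2 (Nat.lt_succ_of_le hk)))
    _ ≤ ENNReal.ofReal (∫ ω, weightedSquares ξ c n ω ∂P) :=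
        (maximal_ineq hsub hnn n).trans (ENNReal.ofReal_le_ofReal
          (setIntegral_le_integral (integrable_weightedSquares c h2 n) (ae_of_all _ (hnn n))))
    _ = ∑ i ∈ Finset.range (n + 1), ENNReal.ofReal (c i * ∫ ω, ξ i ω ^ 2 ∂P) := by
        rw [integral_weightedSquares hξ' hind h2 h0, ENNReal.ofReal_sum_of_nonneg]
        exact fun i _ => mul_nonneg (hc i) (integral_nonneg fun ω => sq_nonneg _)
    _ ≤ _ := ENNReal.sum_le_tsum _

/-! ### Elementary sums. -/

theorem antitone_max_rpow {w s : ℝ} (hw : 0 < w) (hs : s ≤ 0) :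
    Antitone fun x : ℝ => max x w ^ s := fun _ _ hxy =>
  Real.rpow_le_rpow_of_nonpos (lt_max_of_lt_right hw) (max_le_max_right w hxy) hs

/-- Comparison with the integral: the constant stretch [0, w] contributes w^(-b), and the part
beyond w at most w^(-b)/b. -/
theorem sum_max_rpow_le {w b : ℝ} (hw : 0 < w) (hb : 0 < b) (n : ℕ) :
    ∑ i ∈ Finset.range n, max ((i : ℝ) + 1) w ^ (-(1 + b)) ≤ (1 + 1 / b) * w ^ (-b) := by
  -- Enlarging the range to reach w allows the integral to be split at w.
  set N := max n ⌈w⌉₊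
  have hwN : w ≤ N := (Nat.le_ceil w).trans (by exact_mod_cast le_max_right _ _)
  have hanti := antitone_max_rpow (s := -(1 + b)) hw (by linarith)
  have hint : ∀ x y : ℝ, IntervalIntegrable (fun x : ℝ => max x w ^ (-(1 + b))) volume x y :=
    fun x y => hanti.intervalIntegrable
  have h1 : ∫ x in (0 : ℝ)..w, max x w ^ (-(1 + b)) = w ^ (-b) := by
    rw [intervalIntegral.integral_congr (g := fun _ => w ^ (-(1 + b)))]
    · rw [intervalIntegral.integral_const, smul_eq_mul, sub_zero]
      nth_rewrite 1 [← Real.rpow_one w]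
      rw [← Real.rpow_add hw]
      congr 1
      ring
    · intro x hx
      rw [Set.uIcc_of_le hw.le] at hx
      simp [max_eq_right hx.2]
  have h2 : ∫ x in w..(N : ℝ), max x w ^ (-(1 + b)) ≤ 1 / b * w ^ (-b) := by
    rw [intervalIntegral.integral_congr (g := fun x => x ^ (-(1 + b)))]
    · rw [integral_rpow (Or.inr ⟨by linarith, by
        rw [Set.uIcc_of_le hwN]
        exact fun h => hw.not_ge h.1⟩)]
      have e : -(1 + b) + 1 = -b := by ring
      rw [e, div_neg, ← neg_div, neg_sub, one_div, mul_comm, ← div_eq_mul_inv]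
      gcongr
      exact sub_le_self _ (Real.rpow_nonneg (Nat.cast_nonneg _) _)
    · intro x hx
      rw [Set.uIcc_of_le hwN] at hx
      simp [max_eq_left hx.1]
  calc ∑ i ∈ Finset.range n, max ((i : ℝ) + 1) w ^ (-(1 + b))
      ≤ ∑ i ∈ Finset.range N, max ((i : ℝ) + 1) w ^ (-(1 + b)) := by
        refine Finset.sum_le_sum_of_subset_of_nonneg
          (Finset.range_mono (le_max_left _ _)) fun i _ _ => ?_
        exact Real.rpow_nonneg (hw.le.trans (le_max_right _ _)) _
    _ ≤ ∫ x in (0 : ℝ)..N, max x w ^ (-(1 + b)) := by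
        have := AntitoneOn.sum_le_integral (x₀ := 0) (a := N) (hanti.antitoneOn _)
        simpa using this
    _ ≤ _ := by
        rw [← intervalIntegral.integral_add_adjacent_intervals (hint 0 w) (hint w N), h1]
        linarith

theorem tsum_max_rpow_le {w b : ℝ} (hw : 0 < w) (hb : 0 < b) :
    ∑' i : ℕ, ENNReal.ofReal (max ((i : ℝ) + 1) w ^ (-(1 + b))) ≤
      ENNReal.ofReal ((1 + 1 / b) * w ^ (-b)) := by
  refine ENNReal.tsum_le_of_sum_range_le fun n => ?_
  rw [← ENNReal.ofReal_sum_of_nonneg fun i _ => Real.rpow_nonneg (hw.le.trans (le_max_right _ _)) _]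
  exact ENNReal.ofReal_le_ofReal (sum_max_rpow_le hw hb n)

theorem tsum_inv_le_one_add_log {x : ℝ} (hx : 1 ≤ x) :
    ∑' m : ℕ, (if (m : ℝ) + 1 ≤ x then ENNReal.ofReal ((m : ℝ) + 1)⁻¹ else 0) ≤
      ENNReal.ofReal (1 + Real.log x) := by
  rw [tsum_eq_sum (s := Finset.range ⌊x⌋₊)]
  · calc ∑ m ∈ Finset.range ⌊x⌋₊, (if (m : ℝ) + 1 ≤ x then ENNReal.ofReal ((m : ℝ) + 1)⁻¹ else 0)
        ≤ ∑ m ∈ Finset.range ⌊x⌋₊, ENNReal.ofReal ((m : ℝ) + 1)⁻¹ := by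
          gcongr with m
          split_ifs <;> simp
      _ = ENNReal.ofReal (∑ m ∈ Finset.range ⌊x⌋₊, ((m : ℝ) + 1)⁻¹) :=
          (ENNReal.ofReal_sum_of_nonneg fun i _ => by positivity).symm
      _ ≤ _ := by
          refine ENNReal.ofReal_le_ofReal ?_
          have := harmonic_floor_le_one_add_log x hx
          simpa [harmonic] using this
  · intro m hm
    rw [if_neg]
    intro h
    refine hm (Finset.mem_range.2 (Nat.lt_of_succ_le (Nat.le_floor ?_)))
    exact_mod_cast h

/-- At most z indices satisfy k + 1 < z, and none contributes unless m < z. -/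
theorem tsum_indicator_max_lt_le {m z : ℝ} (hz : 0 ≤ z) :
    ∑' k : ℕ, (if max ((k : ℝ) + 1) m < z then (1 : ℝ≥0∞) else 0) ≤
      if m < z then ENNReal.ofReal z else 0 := by
  split_ifs with h
  · rw [tsum_eq_sum (s := Finset.range ⌊z⌋₊)]
    · calc ∑ k ∈ Finset.range ⌊z⌋₊, (if max ((k : ℝ) + 1) m < z then (1 : ℝ≥0∞) else 0)
          ≤ ∑ k ∈ Finset.range ⌊z⌋₊, 1 := by
            gcongr with k
            split_ifs <;> simp
        _ = ENNReal.ofReal (⌊z⌋₊ : ℝ) := by simp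
        _ ≤ _ := ENNReal.ofReal_le_ofReal (Nat.floor_le hz)
    · intro k hk
      rw [if_neg]
      intro h
      refine hk (Finset.mem_range.2 (Nat.lt_of_succ_le (Nat.le_floor ?_)))
      exact_mod_cast ((le_max_left _ _).trans_lt h).le
  · refine le_of_eq (ENNReal.tsum_eq_zero.2 fun k => if_neg fun hk => h ?_)
    exact (le_max_right _ _).trans_lt hk

/-- Bernoulli's inequality for exponents p ≤ 1, applied to n = (n+1)(1 - 1/(n+1)), gives p
(n+1)^(p-1) ≤ (n+1)^p - n^p, which telescopes. -/
theorem sum_rpow_sub_one_le {p : ℝ} (hp : 0 < p) (hp1 : p ≤ 1) (n : ℕ) :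
    ∑ i ∈ Finset.range n, ((i : ℝ) + 1) ^ (p - 1) ≤ (n : ℝ) ^ p / p := by
  induction n with
  | zero => simp [Real.zero_rpow hp.ne']
  | succ n ih =>
    rw [Finset.sum_range_succ]
    have hn : (0 : ℝ) < n + 1 := by positivity
    have hs : -1 ≤ -((n : ℝ) + 1)⁻¹ := neg_le_neg (inv_le_one_of_one_le₀ (by simp))
    have h := rpow_one_add_le_one_add_mul_self hs hp.le hp1
    have e : (n : ℝ) = (n + 1) * (1 + -((n : ℝ) + 1)⁻¹) := by field_simp; ring
    have h1 : (n : ℝ) ^ p ≤ ((n : ℝ) + 1) ^ p - p * ((n : ℝ) + 1) ^ (p - 1) := by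
      calc (n : ℝ) ^ p = (n + 1) ^ p * (1 + -((n : ℝ) + 1)⁻¹) ^ p := by
            rw [← Real.mul_rpow hn.le (by linarith), ← e]
        _ ≤ (n + 1) ^ p * (1 + p * -((n : ℝ) + 1)⁻¹) := by gcongr
        _ = _ := by rw [Real.rpow_sub_one hn.ne']; field_simp; ring
    push_cast
    calc _ ≤ (n : ℝ) ^ p / p + ((n : ℝ) + 1) ^ (p - 1) := by gcongr
      _ ≤ (((n : ℝ) + 1) ^ p - p * ((n : ℝ) + 1) ^ (p - 1)) / p + ((n : ℝ) + 1) ^ (p - 1) := by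
          gcongr
      _ = _ := by field_simp; ring

/-! ### Truncation. -/

/-- The truncation of `x` to the region `|x|^q ≤ N`. -/
noncomputable def truncAt (q N x : ℝ) : ℝ := if |x| ^ q ≤ N then x else 0

theorem measurable_truncAt (q N : ℝ) : Measurable (truncAt q N) := by
  unfold truncAt
  refine Measurable.ite (measurableSet_le ?_ measurable_const) measurable_id measurable_const
  fun_prop

theorem abs_truncAt_le {q N : ℝ} (hq : 0 < q) (hN : 0 ≤ N) (x : ℝ) :
    |truncAt q N x| ≤ N ^ (1 / q) := by
  unfold truncAt
  split_ifs with h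
  · calc |x| = (|x| ^ q) ^ (1 / q) := by
          rw [← Real.rpow_mul (abs_nonneg x), mul_one_div_cancel hq.ne', Real.rpow_one]
      _ ≤ _ := by gcongr
  · simpa using Real.rpow_nonneg hN _

/-- The part of `x` removed by the truncation is controlled by `|x|^q`. -/
theorem abs_sub_truncAt_le {q N m : ℝ} (hq : 1 ≤ q) (hN : 0 < N) (hm : m ≤ N) (x : ℝ) :
    |x - truncAt q N x| ≤ N ^ (1 / q - 1) * (if m < |x| ^ q then |x| ^ q else 0) := by
  unfold truncAt
  split_ifs with h h' h'
  · simpa using by positivity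
  · simp
  · have hz : 0 < |x| ^ q := hN.trans (not_le.1 h)
    have hq0 : 0 < q := by linarith
    -- The exponent 1/q - 1 is nonpositive, so beyond the cutoff the first factor is at most N^(1/q
    -- - 1).
    have e : |x| = (|x| ^ q) ^ (1 / q - 1) * |x| ^ q := by
      rw [Real.rpow_sub_one hz.ne', div_mul_cancel₀ _ hz.ne', ← Real.rpow_mul (abs_nonneg x),
        mul_one_div_cancel hq0.ne', Real.rpow_one]
    rw [sub_zero]
    nth_rewrite 1 [e]
    gcongr ?_ * _
    refine Real.rpow_le_rpow_of_nonpos hN (not_le.1 h).le ?_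
    rw [sub_nonpos, div_le_one hq0]
    exact hq
  · exact absurd (hm.trans_lt (not_le.1 h)) h'

/-- Where the truncation keeps x, inserting |x|^q into the maximum changes nothing; elsewhere the
left side is 0. The right side has a cutoff independent of t, ready to be summed over t = k + 1 by
`tsum_max_rpow_le`. -/
theorem rpow_mul_truncAt_sq_le {q m : ℝ} (hq : 0 < q) (t x : ℝ) (ht : 0 < t) :
    max t m ^ (-(2 / q)) * truncAt q (max t m) x ^ 2 ≤
      (|x| ^ q) ^ (2 / q) * max t (max (|x| ^ q) m) ^ (-(2 / q)) := by
  have hz : 0 ≤ |x| ^ q := by positivity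
  have ht' : 0 < max t (max (|x| ^ q) m) := lt_max_of_lt_left ht
  unfold truncAt
  split_ifs with h
  · have e : x ^ 2 = (|x| ^ q) ^ (2 / q) := by
      rw [← Real.rpow_mul (abs_nonneg x), mul_div_cancel₀ _ hq.ne', Real.rpow_two, sq_abs]
    have e2 : max t (max (|x| ^ q) m) = max t m := by
      rw [max_comm (|x| ^ q), ← max_assoc]
      exact max_eq_left h
    rw [e, e2, mul_comm]
  · simp only [ne_eq, OfNat.ofNat_ne_zero, not_false_eq_true, zero_pow, mul_zero]
    positivity

theorem one_add_one_div_eq_cConst {q : ℝ} (hq : 1 ≤ q) (hq2 : q < 2) :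
    1 + 1 / (2 / q - 1) = cConst q := by
  have hq0 : 0 < q := by linarith
  have : 2 - q ≠ 0 := by linarith
  have h3 : 2 / q - 1 = (2 - q) / q := by field_simp
  rw [cConst, h3]
  field_simp
  ring

theorem partialSum_sub_const {Ω : Type*} [MeasurableSpace Ω] (Y : ℕ → Ω → ℝ) (a : ℕ → ℝ)
    (n : ℕ) (ω : Ω) :
    partialSum (fun k ω => Y k ω - a k) n ω =
      partialSum Y n ω - ∑ i ∈ Finset.range n, a i := Finset.sum_sub_distrib _ _

/-- The variables leave the truncation region with small probability. -/
theorem measure_exists_lt_le {X : ℕ → Ω → ℝ} (hX : ∀ n, Measurable (X n)) {P : Measure Ω}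
    (hid : ∀ n, IdentDistrib (X n) (X 0) P P) (q m : ℝ) :
    P {ω | ∃ k : ℕ, max ((k : ℝ) + 1) m < |X k ω| ^ q} ≤
      ∫⁻ ω, (if m < |X 0 ω| ^ q then ENNReal.ofReal (|X 0 ω| ^ q) else 0) ∂P := by
  have hm : ∀ N : ℝ, MeasurableSet {x : ℝ | N < |x| ^ q} := fun N =>
    measurableSet_lt measurable_const (by fun_prop)
  calc P {ω | ∃ k : ℕ, max ((k : ℝ) + 1) m < |X k ω| ^ q}
      ≤ ∑' k : ℕ, P {ω | max ((k : ℝ) + 1) m < |X k ω| ^ q} := by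
        rw [Set.ofPred_exists]
        exact measure_iUnion_le _
    _ = ∑' k : ℕ, ∫⁻ ω, (if max ((k : ℝ) + 1) m < |X 0 ω| ^ q then 1 else 0) ∂P := by
        refine tsum_congr fun k => ?_
        have h1 := (hid k).measure_mem_eq (hm (max ((k : ℝ) + 1) m))
        refine h1.trans ?_
        rw [← lintegral_indicator_one (hX 0 (hm _))]
        rfl
    _ = ∫⁻ ω, ∑' k : ℕ, (if max ((k : ℝ) + 1) m < |X 0 ω| ^ q then 1 else 0) ∂P := by
        refine (lintegral_tsum fun k => (Measurable.ite (hX 0 (hm _)) measurable_const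
          measurable_const).aemeasurable).symm
    _ ≤ _ := lintegral_mono fun ω => tsum_indicator_max_lt_le (by positivity)

/-- The bias of the truncated partial sums. -/
theorem abs_sum_integral_truncAt_le {X : ℕ → Ω → ℝ} {P : Measure Ω} (hX : ∀ n, Measurable (X n))
    (hP : P ∈ centeredIIDLaws X) {q m : ℝ} (hq : 1 ≤ q)
    (hT : ∫⁻ ω, (if m < |X 0 ω| ^ q then ENNReal.ofReal (|X 0 ω| ^ q) else 0) ∂P ≤
      ENNReal.ofReal (1 / 8)) (hq2 : q ≤ 2) (n : ℕ) :
    |∑ k ∈ Finset.range n, ∫ ω, truncAt q (max ((k : ℝ) + 1) m) (X k ω) ∂P| ≤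
      (n : ℝ) ^ (1 / q) / 4 := by
  obtain ⟨hprob, hind, hid, hint, h0⟩ := hP
  have hq0 : 0 < q := by linarith
  set g : Ω → ℝ := fun ω => if m < |X 0 ω| ^ q then |X 0 ω| ^ q else 0 with hg
  have hgm : Measurable g := by
    have := hX 0
    exact Measurable.ite (measurableSet_lt measurable_const (by fun_prop)) (by fun_prop)
      measurable_const
  have hg0 : ∀ ω, 0 ≤ g ω := fun ω => by
    simp only [hg]
    split_ifs <;> positivity
  have hgo : ∀ ω, ENNReal.ofReal (g ω) =
      if m < |X 0 ω| ^ q then ENNReal.ofReal (|X 0 ω| ^ q) else 0 := fun ω => by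
    simp only [hg]
    split_ifs <;> simp
  simp only [← hgo] at hT
  have hgi : Integrable g P := by
    refine ⟨hgm.aestronglyMeasurable, ?_⟩
    rw [hasFiniteIntegral_iff_ofReal (ae_of_all _ hg0)]
    exact hT.trans_lt ENNReal.ofReal_lt_top
  have hgT : ∫ ω, g ω ∂P ≤ 1 / 8 := by
    rw [integral_eq_lintegral_of_nonneg_ae (ae_of_all _ hg0) hgm.aestronglyMeasurable]
    exact ENNReal.toReal_le_of_le_ofReal (by norm_num) hT
  have hk : ∀ k : ℕ, |∫ ω, truncAt q (max ((k : ℝ) + 1) m) (X k ω) ∂P| ≤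
      ((k : ℝ) + 1) ^ (1 / q - 1) * (1 / 8) := by
    intro k
    set N := max ((k : ℝ) + 1) m
    have hN : 0 < N := lt_max_of_lt_left (by positivity)
    have hb : Integrable (fun ω => truncAt q N (X 0 ω)) P :=
      Integrable.of_bound ((measurable_truncAt q N).comp (hX 0)).aestronglyMeasurable _
        (ae_of_all _ fun ω => abs_truncAt_le hq0 hN.le _)
    have e : ∫ ω, truncAt q N (X k ω) ∂P = ∫ ω, truncAt q N (X 0 ω) ∂P :=
      ((hid k).comp (measurable_truncAt q N)).integral_eq
    -- Since X₁ is centered, the bias is minus the mean of the removed part.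
    have e2 : ∫ ω, truncAt q N (X 0 ω) ∂P = -∫ ω, (X 0 ω - truncAt q N (X 0 ω)) ∂P := by
      rw [integral_sub (hint 0) hb, h0 0]
      ring
    rw [e, e2, abs_neg]
    calc |∫ ω, (X 0 ω - truncAt q N (X 0 ω)) ∂P|
        ≤ ∫ ω, |X 0 ω - truncAt q N (X 0 ω)| ∂P := abs_integral_le_integral_abs
      _ ≤ ∫ ω, N ^ (1 / q - 1) * g ω ∂P :=
          integral_mono ((hint 0).sub hb).abs (hgi.const_mul _)
            fun ω => abs_sub_truncAt_le hq hN (le_max_right _ _) _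
      _ = N ^ (1 / q - 1) * ∫ ω, g ω ∂P := integral_const_mul _ _
      _ ≤ ((k : ℝ) + 1) ^ (1 / q - 1) * (1 / 8) := by
          refine mul_le_mul ?_ hgT (integral_nonneg hg0) (by positivity)
          refine Real.rpow_le_rpow_of_nonpos (by positivity) (le_max_left _ _) ?_
          rw [sub_nonpos, div_le_one hq0]
          exact hq
  calc |∑ k ∈ Finset.range n, ∫ ω, truncAt q (max ((k : ℝ) + 1) m) (X k ω) ∂P|
      ≤ ∑ k ∈ Finset.range n, ((k : ℝ) + 1) ^ (1 / q - 1) * (1 / 8) :=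
        (Finset.abs_sum_le_sum_abs _ _).trans (Finset.sum_le_sum fun k _ => hk k)
    _ ≤ ((n : ℝ) ^ (1 / q) / (1 / q)) * (1 / 8) := by
        rw [← Finset.sum_mul]
        gcongr
        exact sum_rpow_sub_one_le (by positivity) (by rw [div_le_one hq0]; exact hq) n
    _ = (n : ℝ) ^ (1 / q) * (q / 8) := by field_simp
    -- Here q ≤ 2; this is why the threshold 1/8 yields a bias of 1/4.
    _ ≤ (n : ℝ) ^ (1 / q) * (1 / 4) :=
        mul_le_mul_of_nonneg_left (by linarith) (by positivity)
    _ = _ := by ring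

/-- The Hájek–Rényi bound for the truncated and recentered variables. -/
theorem measure_exists_truncAt_le {X : ℕ → Ω → ℝ} (hX : ∀ n, Measurable (X n)) {P : Measure Ω}
    (hP : P ∈ centeredIIDLaws X) {q m : ℝ} (hq : 1 ≤ q) (hq2 : q < 2) (hm : 0 < m) :
    P {ω | ∃ k : ℕ, (1 / 4 : ℝ) ≤ max ((k : ℝ) + 1) m ^ (-(2 / q)) *
        partialSum (fun k ω => truncAt q (max ((k : ℝ) + 1) m) (X k ω) -
          ∫ ω, truncAt q (max ((k : ℝ) + 1) m) (X k ω) ∂P) (k + 1) ω ^ 2} ≤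
      4 * ∫⁻ ω, ENNReal.ofReal (cConst q * ((|X 0 ω| ^ q) ^ (2 / q) *
        max (|X 0 ω| ^ q) m ^ (-(2 / q - 1)))) ∂P := by
  obtain ⟨hprob, hind, hid, hint, h0⟩ := hP
  have hq0 : 0 < q := by linarith
  set N : ℕ → ℝ := fun k => max ((k : ℝ) + 1) m with hNdef
  have hN : ∀ k, 0 < N k := fun k => lt_max_of_lt_right hm
  set a : ℕ → ℝ := fun k => ∫ ω, truncAt q (N k) (X k ω) ∂P with ha
  set ξ : ℕ → Ω → ℝ := fun k ω => truncAt q (N k) (X k ω) - a k with hξ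
  have hYm : ∀ k, Measurable fun ω => truncAt q (N k) (X k ω) :=
    fun k => (measurable_truncAt q (N k)).comp (hX k)
  have hYL : ∀ k, MemLp (fun ω => truncAt q (N k) (X k ω)) 2 P := fun k =>
    MemLp.of_bound (hYm k).aestronglyMeasurable _
      (ae_of_all _ fun ω => abs_truncAt_le hq0 (hN k).le _)
  have hξm : ∀ k, Measurable (ξ k) := fun k => (hYm k).sub_const _
  have hξL : ∀ k, MemLp (ξ k) 2 P := fun k => (hYL k).sub (memLp_const _)
  have hξ0 : ∀ k, ∫ ω, ξ k ω ∂P = 0 := fun k => by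
    simp only [hξ]
    rw [integral_sub ((hYL k).integrable (by norm_num)) (integrable_const _)]
    simp [ha]
  have hξi : iIndepFun ξ P :=
    hind.comp (fun k x => truncAt q (N k) x - a k) fun k => (measurable_truncAt q (N k)).sub_const _
  have hHR := hajek_renyi hξm hξi hξL hξ0 (c := fun k => N k ^ (-(2 / q)))
    (fun k => Real.rpow_nonneg (hN k).le _)
    (fun i j hij => antitone_max_rpow hm (s := -(2 / q))
      (by rw [neg_nonpos]; positivity) (by simpa using hij)) (1 / 4)
  have hV : ∀ k : ℕ, ENNReal.ofReal (N k ^ (-(2 / q)) * ∫ ω, ξ k ω ^ 2 ∂P) ≤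
      ∫⁻ ω, ENNReal.ofReal ((|X 0 ω| ^ q) ^ (2 / q)) *
        ENNReal.ofReal (max ((k : ℝ) + 1) (max (|X 0 ω| ^ q) m) ^ (-(2 / q))) ∂P := by
    intro k
    have hY0 : MemLp (fun ω => truncAt q (N k) (X 0 ω)) 2 P :=
      MemLp.of_bound ((measurable_truncAt q (N k)).comp (hX 0)).aestronglyMeasurable _
        (ae_of_all _ fun ω => abs_truncAt_le hq0 (hN k).le _)
    -- The variance is at most the second moment.
    have h1 : ∫ ω, ξ k ω ^ 2 ∂P ≤ ∫ ω, truncAt q (N k) (X k ω) ^ 2 ∂P := by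
      have := variance_le_expectation_sq (μ := P) (hYm k).aestronglyMeasurable
      rwa [variance_eq_integral (hYm k).aemeasurable] at this
    have h2 : ∫ ω, truncAt q (N k) (X k ω) ^ 2 ∂P = ∫ ω, truncAt q (N k) (X 0 ω) ^ 2 ∂P :=
      ((hid k).comp ((measurable_truncAt q (N k)).pow_const 2)).integral_eq
    calc ENNReal.ofReal (N k ^ (-(2 / q)) * ∫ ω, ξ k ω ^ 2 ∂P)
        ≤ ENNReal.ofReal (∫ ω, N k ^ (-(2 / q)) * truncAt q (N k) (X 0 ω) ^ 2 ∂P) := by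
          rw [integral_const_mul, ← h2]
          have := Real.rpow_nonneg (hN k).le (-(2 / q))
          gcongr
      _ = ∫⁻ ω, ENNReal.ofReal (N k ^ (-(2 / q)) * truncAt q (N k) (X 0 ω) ^ 2) ∂P :=
          ofReal_integral_eq_lintegral_ofReal (hY0.integrable_sq.const_mul _)
            (ae_of_all _ fun ω => mul_nonneg (Real.rpow_nonneg (hN k).le _) (sq_nonneg _))
      _ ≤ _ := by
          refine lintegral_mono fun ω => ?_
          dsimp only
          rw [← ENNReal.ofReal_mul (by positivity)]
          exact ENNReal.ofReal_le_ofReal (rpow_mul_truncAt_sq_le hq0 _ _ (by positivity))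
  have hXm := hX 0
  have hsum : ∑' k, ENNReal.ofReal (N k ^ (-(2 / q)) * ∫ ω, ξ k ω ^ 2 ∂P) ≤
      ∫⁻ ω, ENNReal.ofReal (cConst q * ((|X 0 ω| ^ q) ^ (2 / q) *
        max (|X 0 ω| ^ q) m ^ (-(2 / q - 1)))) ∂P := by
    refine (ENNReal.tsum_le_tsum hV).trans ?_
    rw [← lintegral_tsum fun k => by fun_prop]
    refine lintegral_mono fun ω => ?_
    dsimp only
    rw [ENNReal.tsum_mul_left]
    have hb : 0 < 2 / q - 1 := by rw [sub_pos, lt_div_iff₀ hq0]; linarith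
    -- For fixed ω the sum over k has exponent -(1 + b) = -2/q and produces the factor 1 + 1/b =
    -- c_q.
    have hA := tsum_max_rpow_le (w := max (|X 0 ω| ^ q) m) (lt_max_of_lt_right hm) hb
    rw [add_sub_cancel, one_add_one_div_eq_cConst hq hq2] at hA
    calc _ ≤ ENNReal.ofReal ((|X 0 ω| ^ q) ^ (2 / q)) *
          ENNReal.ofReal (cConst q * max (|X 0 ω| ^ q) m ^ (-(2 / q - 1))) := by gcongr
      _ = _ := by
        rw [← ENNReal.ofReal_mul (by positivity)]
        congr 1
        ring
  have h4 : (4 : ℝ≥0∞) * ((1 / 4 : NNReal) : ℝ≥0∞) = 1 := by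
    rw [show (4 : ℝ≥0∞) = ((4 : NNReal) : ℝ≥0∞) by rfl, ← ENNReal.coe_mul]
    norm_num
  calc _ = 4 * (((1 / 4 : NNReal) : ℝ≥0∞) * P {ω | ∃ k : ℕ, (((1 / 4 : NNReal) : ℝ)) ≤
        N k ^ (-(2 / q)) * partialSum ξ (k + 1) ω ^ 2}) := by
        rw [← mul_assoc, h4, one_mul]
        norm_num [hNdef]
    _ ≤ _ := by
        gcongr
        exact hHR.trans hsum

/-! ### Bound for a single tail probability. -/

theorem exists_lt_of_ofReal_le_iSup {Ω : Type*} [MeasurableSpace Ω] {X : ℕ → Ω → ℝ} {q : ℝ}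
    {m : ℕ} {ω : Ω} {r ε : ℝ} (hr : r < ε) (hε : 0 < ε)
    (h : ENNReal.ofReal ε ≤
      ⨆ k : ℕ, ⨆ _ : m ≤ k, ENNReal.ofReal |(k : ℝ) ^ (-(1 / q)) * partialSum X k ω|) :
    ∃ k, m ≤ k ∧ r < |(k : ℝ) ^ (-(1 / q)) * partialSum X k ω| := by
  have := ((ENNReal.ofReal_lt_ofReal_iff hε).2 hr).trans_le h
  obtain ⟨k, hk⟩ := lt_iSup_iff.1 this
  obtain ⟨hmk, hk⟩ := lt_iSup_iff.1 hk
  exact ⟨k, hmk, (ENNReal.ofReal_lt_ofReal_iff'.1 hk).1⟩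

theorem tailProb_one_le {X : ℕ → Ω → ℝ} (hX : ∀ n, Measurable (X n)) {P : Measure Ω}
    (hP : P ∈ centeredIIDLaws X) {q : ℝ} (hq : 1 ≤ q) (hq2 : q < 2) {m : ℕ} (hm : 0 < m) :
    tailProb X P q 1 m ≤
      9 * ∫⁻ ω, (if (m : ℝ) < |X 0 ω| ^ q then ENNReal.ofReal (|X 0 ω| ^ q) else 0) ∂P +
      4 * ∫⁻ ω, ENNReal.ofReal (cConst q * ((|X 0 ω| ^ q) ^ (2 / q) *
        max (|X 0 ω| ^ q) m ^ (-(2 / q - 1)))) ∂P := by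
  set T := ∫⁻ ω, (if (m : ℝ) < |X 0 ω| ^ q then ENNReal.ofReal (|X 0 ω| ^ q) else 0) ∂P with hTdef
  have hprob : IsProbabilityMeasure P := hP.1
  rcases lt_or_ge (ENNReal.ofReal (1 / 8)) T with hT | hT
  · refine le_add_right ?_
    calc tailProb X P q 1 m ≤ 1 := prob_le_one
      _ ≤ 9 * ENNReal.ofReal (1 / 8) := by
          rw [show (9 : ℝ≥0∞) = ENNReal.ofReal 9 by simp, ← ENNReal.ofReal_mul (by norm_num),
            ENNReal.one_le_ofReal]
          norm_num
      _ ≤ 9 * T := by gcongr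
  · have h1 := measure_exists_lt_le hX hP.2.2.1 q m
    have h2 := measure_exists_truncAt_le hX hP hq hq2 (m := m) (by exact_mod_cast hm)
    calc tailProb X P q 1 m
        ≤ P ({ω | ∃ k : ℕ, max ((k : ℝ) + 1) m < |X k ω| ^ q} ∪
          {ω | ∃ k : ℕ, (1 / 4 : ℝ) ≤ max ((k : ℝ) + 1) m ^ (-(2 / q)) *
            partialSum (fun k ω => truncAt q (max ((k : ℝ) + 1) m) (X k ω) -
              ∫ ω, truncAt q (max ((k : ℝ) + 1) m) (X k ω) ∂P) (k + 1) ω ^ 2}) := by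
          refine measure_mono fun ω hω => ?_
          rw [Set.mem_union, or_iff_not_imp_left]
          intro hno
          simp only [Set.mem_ofPred_eq, not_exists, not_lt] at hno
          -- The supremum need not be attained, so 1 is lowered to 3/4. Removing the bias 1/4 leaves
          -- 1/2, whose square is the Hájek–Rényi level 1/4.
          obtain ⟨k, hmk, hk⟩ := exists_lt_of_ofReal_le_iSup (r := 3 / 4) (by norm_num)
            one_pos hω
          obtain ⟨j, rfl⟩ : ∃ j, k = j + 1 := ⟨k - 1, by omega⟩
          refine ⟨j, ?_⟩
          have hj : (0 : ℝ) < (j : ℝ) + 1 := by positivity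
          -- As k = j + 1 ≥ m, the weight is exactly k^(-2/q).
          have hmax : max ((j : ℝ) + 1) m = (j : ℝ) + 1 := max_eq_left (by exact_mod_cast hmk)
          have hbias := abs_sum_integral_truncAt_le hX hP hq hT hq2.le (j + 1)
          have hS : partialSum (fun k ω => truncAt q (max ((k : ℝ) + 1) m) (X k ω)) (j + 1) ω =
              partialSum X (j + 1) ω :=
            Finset.sum_congr rfl fun i _ => if_pos (hno i)
          rw [hmax, partialSum_sub_const, hS]
          push_cast at hk hbias
          set A := ∑ k ∈ Finset.range (j + 1),
            ∫ ω, truncAt q (max ((k : ℝ) + 1) m) (X k ω) ∂P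
          set S := partialSum X (j + 1) ω
          set u := ((j : ℝ) + 1) ^ (-(1 / q)) with hu
          have hu0 : 0 < u := Real.rpow_pos_of_pos hj _
          have hinv : ((j : ℝ) + 1) ^ (1 / q) * u = 1 := by
            rw [hu, ← Real.rpow_add hj, add_neg_cancel, Real.rpow_zero]
          have hu2 : ((j : ℝ) + 1) ^ (-(2 / q)) = u ^ 2 := by
            rw [hu, ← Real.rpow_natCast, ← Real.rpow_mul hj.le]
            congr 1
            push_cast
            ring
          have hA : |u * A| ≤ 1 / 4 := by
            rw [abs_mul, abs_of_pos hu0]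
            nlinarith
          have h5 : 1 / 2 ≤ |u * S - u * A| := by
            have := abs_sub_abs_le_abs_sub (u * S) (u * A)
            linarith
          rw [hu2, ← mul_pow, ← sq_abs, mul_sub]
          nlinarith
      _ ≤ T + 4 * _ := (measure_union_le _ _).trans (add_le_add h1 h2)
      _ ≤ _ := by
          gcongr
          exact le_mul_of_one_le_left zero_le (by norm_num)

/-! ### Summation over m. -/

/-- If z ≥ e^l, then log z ≥ l ≥ c/2 absorbs c. Otherwise, for z > 0, the left side is c z e^(-y)
with y = b(l - log z) ≥ 0; then c ≤ 2(y + log⁺ z), and e^(-y) y ≤ 1. -/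
theorem mul_rpow_mul_max_rpow_le {b c l z : ℝ} (hb : 0 < b) (hb1 : b ≤ 1) (hc : 0 < c)
    (hl : c / 2 ≤ b * l) (hz : 0 ≤ z) :
    c * (z ^ (1 + b) * max (Real.exp l) z ^ (-b)) ≤ 2 * z * (1 + max 0 (Real.log z)) := by
  have hl0 : 0 < l := pos_of_mul_pos_right (by linarith) hb.le
  rcases hz.eq_or_lt with rfl | hz
  · rw [Real.zero_rpow (by linarith)]
    simp
  have hu0 := le_max_left 0 (Real.log z)
  have hu1 := le_max_right 0 (Real.log z)
  set u := max 0 (Real.log z)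
  rcases le_total (Real.exp l) z with h | h
  · rw [max_eq_right h, ← Real.rpow_add hz, add_neg_cancel_right, Real.rpow_one]
    have h1 : l ≤ Real.log z := (Real.le_log_iff_exp_le hz).2 h
    have h2 : c ≤ 2 * (1 + u) := by nlinarith
    nlinarith
  · rw [max_eq_left h]
    set y := b * (l - Real.log z) with hy
    have h1 : Real.log z ≤ l := (Real.log_le_iff_le_exp hz).2 h
    have hy0 : 0 ≤ y := mul_nonneg hb.le (sub_nonneg.2 h1)
    have e : z ^ (1 + b) * Real.exp l ^ (-b) = z * Real.exp (-y) := by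
      rw [Real.rpow_add hz, Real.rpow_one, mul_assoc, Real.rpow_def_of_pos hz, ← Real.exp_mul,
        ← Real.exp_add, hy]
      ring_nf
    have h3 : c ≤ 2 * (y + u) := by nlinarith
    have h4 : Real.exp (-y) * (y + u) ≤ 1 + u := by
      have h5 : Real.exp (-y) * Real.exp y = 1 := by rw [← Real.exp_add]; simp
      have h6 := Real.add_one_le_exp y
      have h7 := Real.exp_pos (-y)
      have h8 : Real.exp (-y) ≤ 1 := Real.exp_le_one_iff.2 (by linarith)
      nlinarith
    rw [e]
    calc c * (z * Real.exp (-y)) = z * (Real.exp (-y) * c) := by ring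
      _ ≤ z * (Real.exp (-y) * (2 * (y + u))) := by gcongr
      _ ≤ 2 * z * (1 + u) := by nlinarith

theorem add_le_of_log {b c l z : ℝ} (hb : 0 < b) (hb1 : b ≤ 1) (hc : 2 ≤ c)
    (hl : c / 2 ≤ b * l) (hz : 0 ≤ z) :
    (if 1 ≤ z then (9 + 4 * c) * z * (1 + Real.log z) else 0) +
      4 * c * (c * (z ^ (1 + b) * max (Real.exp l) z ^ (-b))) ≤
    l + 2603 / 2 * c * (z * Real.log (38 * z + 1)) := by
  have hl0 : c / 2 ≤ l := by nlinarith
  have hkey := mul_rpow_mul_max_rpow_le hb hb1 (by linarith) hl hz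
  have hcz : 0 ≤ c * z := by positivity
  have h4 := mul_le_mul_of_nonneg_left hkey (show 0 ≤ 4 * c by linarith)
  refine (add_le_add_right h4 _).trans ?_
  split_ifs with h
  · rw [max_eq_right (Real.log_nonneg h)]
    -- This amounts to e z ≤ 38 z + 1.
    have hlog : 1 + Real.log z ≤ Real.log (38 * z + 1) := by
      rw [Real.le_log_iff_exp_le (by positivity), Real.exp_add, Real.exp_log (by linarith)]
      have := Real.exp_one_lt_d9
      nlinarith
    have h1 : 0 ≤ 1 + Real.log z := by linarith [Real.log_nonneg h]
    have h2 : 0 ≤ z * (1 + Real.log z) := mul_nonneg hz h1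
    have h3 := mul_le_mul_of_nonneg_left hlog hcz
    nlinarith [mul_le_mul_of_nonneg_right hc h2]
  · have hz1 : z < 1 := not_le.1 h
    rw [max_eq_left (Real.log_nonpos hz hz1.le)]
    -- Below 1/38 the term 8 c z is less than c/2 ≤ l; above it, 38 z + 1 ≥ 2 and log 2 > 1/2.
    rcases le_total z (1 / 38) with hz2 | hz2
    · have : 0 ≤ Real.log (38 * z + 1) := Real.log_nonneg (by linarith)
      have : 0 ≤ z * Real.log (38 * z + 1) := mul_nonneg hz this
      nlinarith
    · have : Real.log 2 ≤ Real.log (38 * z + 1) := Real.log_le_log (by norm_num) (by linarith)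
      have := Real.log_two_gt_d9
      have h1 : 1 / 2 ≤ Real.log (38 * z + 1) := by linarith
      have := mul_le_mul_of_nonneg_left h1 hcz
      nlinarith

theorem tsum_term_le {b c l z : ℝ} (hb : 0 < b) (hb1 : b ≤ 1) (hc : 2 ≤ c) (hbc : 1 + 1 / b = c)
    (hl : c / 2 ≤ b * l) (hz : 0 ≤ z) :
    ∑' m : ℕ, (if (m : ℝ) + 1 ≤ Real.exp l then 0 else ENNReal.ofReal ((m : ℝ) + 1)⁻¹ *
      (9 * (if (m : ℝ) + 1 < z then ENNReal.ofReal z else 0) +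
        4 * ENNReal.ofReal (c * (z ^ (1 + b) * max z ((m : ℝ) + 1) ^ (-b))))) ≤
    ENNReal.ofReal l + ENNReal.ofReal (2603 / 2 * c) *
      ENNReal.ofReal (z * Real.log (38 * z + 1)) := by
  have hl0 : 0 < l := pos_of_mul_pos_right (by linarith) hb.le
  have hw : 0 < max (Real.exp l) z := lt_max_of_lt_left (Real.exp_pos l)
  have hc0 : 0 ≤ c := by linarith
  have hterm : ∀ m : ℕ, (if (m : ℝ) + 1 ≤ Real.exp l then 0 else ENNReal.ofReal ((m : ℝ) + 1)⁻¹ *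
      (9 * (if (m : ℝ) + 1 < z then ENNReal.ofReal z else 0) +
        4 * ENNReal.ofReal (c * (z ^ (1 + b) * max z ((m : ℝ) + 1) ^ (-b))))) ≤
      ENNReal.ofReal ((9 + 4 * c) * z) *
        (if (m : ℝ) + 1 ≤ z then ENNReal.ofReal ((m : ℝ) + 1)⁻¹ else 0) +
      ENNReal.ofReal (4 * c * z ^ (1 + b)) *
        ENNReal.ofReal (max ((m : ℝ) + 1) (max (Real.exp l) z) ^ (-(1 + b))) := by
    intro m
    have hm : (0 : ℝ) < (m : ℝ) + 1 := by positivity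
    have h9 : (9 : ℝ≥0∞) = ENNReal.ofReal 9 := by simp
    have h4 : (4 : ℝ≥0∞) = ENNReal.ofReal 4 := by simp
    by_cases h1 : (m : ℝ) + 1 ≤ Real.exp l
    · rw [if_pos h1]
      exact zero_le
    rw [if_neg h1]
    -- For m + 1 ≤ z the power term collapses to c z; beyond z only the power term survives, and the
    -- maximum with e^l and z is m + 1 itself.
    by_cases h2 : (m : ℝ) + 1 ≤ z
    · have hz0 : 0 < z := hm.trans_le h2
      have hif : (if (m : ℝ) + 1 < z then ENNReal.ofReal z else 0) ≤ ENNReal.ofReal z := by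
        split_ifs <;> simp
      refine le_add_right ?_
      rw [if_pos h2, max_eq_left h2, ← Real.rpow_add hz0, add_neg_cancel_right, Real.rpow_one]
      calc _ ≤ ENNReal.ofReal ((m : ℝ) + 1)⁻¹ *
            (9 * ENNReal.ofReal z + 4 * ENNReal.ofReal (c * z)) := by gcongr
        _ = _ := by
          rw [h9, h4, ← ENNReal.ofReal_mul (by norm_num), ← ENNReal.ofReal_mul (by norm_num),
            ← ENNReal.ofReal_add (by positivity) (by positivity), mul_comm]
          ring_nf
    · refine le_add_left (le_of_eq ?_)
      have h3 : z ≤ (m : ℝ) + 1 := (not_le.1 h2).le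
      have e : -(1 + b) = -1 + -b := by ring
      rw [if_neg (not_lt.2 h3), max_eq_right h3, max_eq_left (max_le (not_le.1 h1).le h3), h4,
        mul_zero, zero_add, ← ENNReal.ofReal_mul (by norm_num),
        ← ENNReal.ofReal_mul (by positivity), ← ENNReal.ofReal_mul (by positivity), e,
        Real.rpow_add hm, Real.rpow_neg_one]
      ring_nf
  refine (ENNReal.tsum_le_tsum hterm).trans ?_
  rw [ENNReal.tsum_add, ENNReal.tsum_mul_left, ENNReal.tsum_mul_left]
  have hA := tsum_max_rpow_le hw hb
  rw [hbc] at hA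
  have hB : ∑' m : ℕ, (if (m : ℝ) + 1 ≤ z then ENNReal.ofReal ((m : ℝ) + 1)⁻¹ else 0) ≤
      ENNReal.ofReal (if 1 ≤ z then 1 + Real.log z else 0) := by
    split_ifs with h
    · exact tsum_inv_le_one_add_log h
    · refine le_of_eq ?_
      rw [ENNReal.ofReal_zero, ENNReal.tsum_eq_zero]
      intro m
      rw [if_neg]
      intro hm
      have : (0 : ℝ) ≤ m := Nat.cast_nonneg m
      linarith
  have hlog : 0 ≤ Real.log (38 * z + 1) := Real.log_nonneg (by linarith)
  have hif : 0 ≤ if 1 ≤ z then 1 + Real.log z else 0 := by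
    split_ifs with h
    · linarith [Real.log_nonneg h]
    · exact le_rfl
  calc _ ≤ ENNReal.ofReal ((9 + 4 * c) * z) * ENNReal.ofReal (if 1 ≤ z then 1 + Real.log z else 0) +
        ENNReal.ofReal (4 * c * z ^ (1 + b)) * ENNReal.ofReal (c * max (Real.exp l) z ^ (-b)) := by
        gcongr
    _ = ENNReal.ofReal ((if 1 ≤ z then (9 + 4 * c) * z * (1 + Real.log z) else 0) +
          4 * c * (c * (z ^ (1 + b) * max (Real.exp l) z ^ (-b)))) := by
        rw [← ENNReal.ofReal_mul (by positivity), ← ENNReal.ofReal_mul (by positivity),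
          ← ENNReal.ofReal_add (by positivity) (by positivity), mul_ite, mul_zero]
        ring_nf
    _ ≤ _ := by
        rw [← ENNReal.ofReal_mul (by positivity), ← ENNReal.ofReal_add hl0.le (by positivity)]
        exact ENNReal.ofReal_le_ofReal (add_le_of_log hb hb1 hc hl hz)

/-- The logarithm equals b (log 2)/2, so the right side is c_q/(e log 2), and the claim is e log 2 ≤
2. -/
theorem cConst_div_two_le {q : ℝ} (hq : 1 ≤ q) (hq2 : q < 2) :
    cConst q / 2 ≤ (2 / q - 1) *
      (cConst q / (Real.exp 1 * Real.log ((2 : ℝ) ^ (1 / q - 1 / 2))) / 2) := by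
  have hq0 : 0 < q := by linarith
  have hb : 0 < 2 / q - 1 := by rw [sub_pos, lt_div_iff₀ hq0]; linarith
  have hc : 0 ≤ cConst q := div_nonneg (by norm_num) (by linarith)
  have h2 := Real.log_pos one_lt_two
  have hlog : Real.log ((2 : ℝ) ^ (1 / q - 1 / 2)) = (2 / q - 1) * (Real.log 2 / 2) := by
    rw [Real.log_rpow (by norm_num)]
    ring
  rw [hlog]
  have e : (2 / q - 1) * (cConst q / (Real.exp 1 * ((2 / q - 1) * (Real.log 2 / 2))) / 2) =
      cConst q / (Real.exp 1 * Real.log 2) := by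
    generalize 2 / q - 1 = b at hb
    field_simp
  rw [e]
  refine div_le_div_of_nonneg_left hc (by positivity) ?_
  have := Real.exp_one_lt_d9
  have := Real.log_two_lt_d9
  nlinarith

theorem tailSeries_one_le {X : ℕ → Ω → ℝ} (hX : ∀ n, Measurable (X n)) {P : Measure Ω}
    (hP : P ∈ centeredIIDLaws X) {q : ℝ} (hq : 1 ≤ q) (hq2 : q < 2) :
    tailSeries X P q 1 ≤
      ENNReal.ofReal (1 + cConst q / (Real.exp 1 * Real.log ((2 : ℝ) ^ (1 / q - 1 / 2)))) +
      ENNReal.ofReal (2603 / 2 * cConst q) * logMoment X P q 38 := by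
  have hprob : IsProbabilityMeasure P := hP.1
  have hq0 : 0 < q := by linarith
  have hb : 0 < 2 / q - 1 := by rw [sub_pos, lt_div_iff₀ hq0]; linarith
  have hb1 : 2 / q - 1 ≤ 1 := by
    have : 2 / q ≤ 2 := (div_le_self (by norm_num) hq)
    linarith
  have hbc := one_add_one_div_eq_cConst hq hq2
  have hc : 2 ≤ cConst q := by
    rw [cConst, le_div_iff₀ (by linarith)]
    linarith
  have hl := cConst_div_two_le hq hq2
  set L := cConst q / (Real.exp 1 * Real.log ((2 : ℝ) ^ (1 / q - 1 / 2))) with hL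
  have hL0 : 0 < L / 2 := pos_of_mul_pos_right (by linarith) hb.le
  have hXm := hX 0
  set F : ℕ → Ω → ℝ≥0∞ := fun m ω => if (m : ℝ) + 1 ≤ Real.exp (L / 2) then 0 else
    ENNReal.ofReal ((m : ℝ) + 1)⁻¹ *
      (9 * (if (m : ℝ) + 1 < |X 0 ω| ^ q then ENNReal.ofReal (|X 0 ω| ^ q) else 0) +
        4 * ENNReal.ofReal (cConst q * ((|X 0 ω| ^ q) ^ (1 + (2 / q - 1)) *
          max (|X 0 ω| ^ q) ((m : ℝ) + 1) ^ (-(2 / q - 1))))) with hF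
  have hm1 : ∀ m : ℕ, Measurable fun ω =>
      if (m : ℝ) + 1 < |X 0 ω| ^ q then ENNReal.ofReal (|X 0 ω| ^ q) else 0 := fun m =>
    Measurable.ite (measurableSet_lt measurable_const (by fun_prop)) (by fun_prop)
      measurable_const
  have hFm : ∀ m, Measurable (F m) := fun m => by
    simp only [hF]
    split_ifs
    · exact measurable_const
    · exact (((hm1 m).const_mul _).add (by fun_prop)).const_mul _
  have hterm : ∀ m : ℕ, tailProb X P q 1 (m + 1) / ((m + 1 : ℕ) : ℝ≥0∞) ≤
      (if (m : ℝ) + 1 ≤ Real.exp (L / 2) then ENNReal.ofReal ((m : ℝ) + 1)⁻¹ else 0) +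
        ∫⁻ ω, F m ω ∂P := by
    intro m
    have hinv : ((m + 1 : ℕ) : ℝ≥0∞)⁻¹ = ENNReal.ofReal ((m : ℝ) + 1)⁻¹ := by
      rw [ENNReal.ofReal_inv_of_pos (by positivity)]
      congr 1
      exact_mod_cast (ENNReal.ofReal_natCast (m + 1)).symm
    rw [div_eq_mul_inv, hinv]
    -- On the initial block the probability is bounded by 1.
    by_cases h : (m : ℝ) + 1 ≤ Real.exp (L / 2)
    · rw [if_pos h]
      exact le_add_right (mul_le_of_le_one_left zero_le prob_le_one)
    · rw [if_neg h, zero_add]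
      simp only [hF, if_neg h]
      have hT := tailProb_one_le hX hP hq hq2 m.succ_pos
      push_cast [Nat.succ_eq_add_one] at hT
      rw [lintegral_const_mul' _ _ ENNReal.ofReal_ne_top,
        lintegral_add_left ((hm1 m).const_mul _), lintegral_const_mul _ (hm1 m),
        lintegral_const_mul _ (by fun_prop), add_sub_cancel, mul_comm]
      gcongr
  calc tailSeries X P q 1
      = ∑' m : ℕ, tailProb X P q 1 (m + 1) / ((m + 1 : ℕ) : ℝ≥0∞) :=
        tsum_pnat_eq_tsum_succ (f := fun m : ℕ => tailProb X P q 1 m / (m : ℝ≥0∞))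
    _ ≤ ∑' m : ℕ, ((if (m : ℝ) + 1 ≤ Real.exp (L / 2) then
          ENNReal.ofReal ((m : ℝ) + 1)⁻¹ else 0) + ∫⁻ ω, F m ω ∂P) := ENNReal.tsum_le_tsum hterm
    _ ≤ ENNReal.ofReal (1 + L / 2) + ∫⁻ ω, ∑' m, F m ω ∂P := by
        rw [ENNReal.tsum_add, lintegral_tsum fun m => (hFm m).aemeasurable]
        gcongr
        simpa using tsum_inv_le_one_add_log (Real.one_le_exp hL0.le)
    _ ≤ ENNReal.ofReal (1 + L / 2) + ∫⁻ ω, (ENNReal.ofReal (L / 2) +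
          ENNReal.ofReal (2603 / 2 * cConst q) *
            ENNReal.ofReal (|X 0 ω| ^ q * Real.log (38 * |X 0 ω| ^ q + 1))) ∂P := by
        gcongr with ω
        exact tsum_term_le hb hb1 hc hbc hl (by positivity)
    -- One half of L comes from the initial block, the other from `tsum_term_le`.
    _ = _ := by
        rw [lintegral_add_left measurable_const, lintegral_const, measure_univ, mul_one,
          lintegral_const_mul' _ _ ENNReal.ofReal_ne_top, ← add_assoc,
          ← ENNReal.ofReal_add (by positivity) hL0.le, logMoment,
          add_assoc 1, add_halves]

/-! ### Scaling to general ε. -/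

theorem mul_const_mem_centeredIIDLaws {X : ℕ → Ω → ℝ} {P : Measure Ω}
    (hP : P ∈ centeredIIDLaws X) (a : ℝ) :
    P ∈ centeredIIDLaws fun n ω => a * X n ω := by
  obtain ⟨hprob, hind, hid, hint, h0⟩ := hP
  refine ⟨hprob, hind.comp (fun _ x => a * x) fun _ => measurable_const_mul a,
    fun n => (hid n).comp (measurable_const_mul a), fun n => (hint n).const_mul a, fun n => ?_⟩
  rw [integral_const_mul, h0, mul_zero]

theorem tailSeries_eq_tailSeries_one (X : ℕ → Ω → ℝ) (P : Measure Ω) (q : ℝ) {ε : ℝ}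
    (hε : 0 < ε) : tailSeries X P q ε = tailSeries (fun n ω => ε⁻¹ * X n ω) P q 1 := by
  unfold tailSeries tailProb
  have hε' : 0 < ε⁻¹ := inv_pos.2 hε
  refine tsum_congr fun m => ?_
  congr 3
  ext ω
  have h : ∀ k : ℕ, ENNReal.ofReal
      |(k : ℝ) ^ (-(1 / q)) * partialSum (fun n ω => ε⁻¹ * X n ω) k ω| =
      ENNReal.ofReal ε⁻¹ * ENNReal.ofReal |(k : ℝ) ^ (-(1 / q)) * partialSum X k ω| := by
    intro k
    rw [← ENNReal.ofReal_mul hε'.le, partialSum, ← Finset.mul_sum, partialSum, mul_left_comm,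
      abs_mul ε⁻¹, abs_of_pos hε']
  have h1 : ENNReal.ofReal 1 = ENNReal.ofReal ε⁻¹ * ENNReal.ofReal ε := by
    rw [← ENNReal.ofReal_mul hε'.le, inv_mul_cancel₀ hε.ne']
  simp only [h, ← ENNReal.mul_iSup]
  rw [h1, ENNReal.mul_le_mul_iff_right (ENNReal.ofReal_pos.2 hε').ne' ENNReal.ofReal_ne_top]

theorem logMoment_inv_mul (X : ℕ → Ω → ℝ) (P : Measure Ω) (q a : ℝ) {ε : ℝ} (hε : 0 < ε) :
    logMoment (fun n ω => ε⁻¹ * X n ω) P q a =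
      ENNReal.ofReal (ε ^ q)⁻¹ * logMoment X P q (a / ε ^ q) := by
  unfold logMoment
  rw [← lintegral_const_mul' _ _ ENNReal.ofReal_ne_top]
  refine lintegral_congr fun ω => ?_
  rw [← ENNReal.ofReal_mul (by positivity), abs_mul, abs_of_pos (inv_pos.2 hε),
    Real.mul_rpow (by positivity) (abs_nonneg _), Real.inv_rpow hε.le]
  ring_nf

theorem min_sq_one_le_rpow {q ε : ℝ} (hq : 0 ≤ q) (hq2 : q ≤ 2) (hε : 0 < ε) :
    min (ε ^ 2) 1 ≤ ε ^ q := by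
  rcases le_total ε 1 with h | h
  · refine (min_le_left _ _).trans ?_
    rw [← Real.rpow_two]
    exact Real.rpow_le_rpow_of_exponent_ge hε h hq2
  · exact (min_le_right _ _).trans (Real.one_le_rpow h hq)

theorem tailSeries_le {X : ℕ → Ω → ℝ} (hX : ∀ n, Measurable (X n)) {P : Measure Ω}
    (hP : P ∈ centeredIIDLaws X) {q : ℝ} (hq : 1 ≤ q) (hq2 : q < 2) {ε : ℝ} (hε : 0 < ε) :
    tailSeries X P q ε ≤
      ENNReal.ofReal (1 + cConst q / (Real.exp 1 * Real.log ((2 : ℝ) ^ (1 / q - 1 / 2)))) +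
      2603 * logMoment X P q (38 / ε ^ q) / ENNReal.ofReal ((2 - q) * min (ε ^ 2) 1) := by
  have h := tailSeries_one_le (fun n => (hX n).const_mul ε⁻¹)
    (mul_const_mem_centeredIIDLaws hP ε⁻¹) hq hq2
  rw [← tailSeries_eq_tailSeries_one X P q hε, logMoment_inv_mul X P q 38 hε] at h
  refine h.trans (add_le_add_right ?_ _)
  have hmin : 0 < min (ε ^ 2) 1 := lt_min (by positivity) one_pos
  have h2q : 0 < 2 - q := by linarith
  have hc : 0 ≤ cConst q := div_nonneg (by norm_num) h2q.le
  rw [← mul_assoc, ← ENNReal.ofReal_mul (by positivity), mul_comm 2603, mul_div_assoc, mul_comm]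
  gcongr
  rw [show (2603 : ℝ≥0∞) = ENNReal.ofReal 2603 by simp, ← ENNReal.ofReal_div_of_pos (by positivity)]
  refine ENNReal.ofReal_le_ofReal ?_
  calc 2603 / 2 * cConst q * (ε ^ q)⁻¹ = 2603 / ((2 - q) * ε ^ q) := by
        rw [cConst]
        field_simp
    -- Scaling gives ε^q in the denominator, which is replaced by the smaller min(ε², 1).
    _ ≤ _ := by
        gcongr
        exact min_sq_one_le_rpow (by linarith) hq2.le hε

/-! ### Uniformity over a family of laws. -/

/-- From a y + 1 ≤ (a + 1)(y + 1) the logarithm splits. The leftover y log(a + 1) is absorbed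
through y ≤ 2 + y log(y + 1), valid since log 3 > 1. -/
theorem mul_log_mul_add_one_le {a y : ℝ} (ha : 0 ≤ a) (hy : 0 ≤ y) :
    y * Real.log (a * y + 1) ≤
      2 * Real.log (a + 1) + (Real.log (a + 1) + 1) * (y * Real.log (1 * y + 1)) := by
  rw [one_mul]
  have hA : 0 ≤ Real.log (a + 1) := Real.log_nonneg (by linarith)
  have hY : 0 ≤ Real.log (y + 1) := Real.log_nonneg (by linarith)
  have h1 : Real.log (a * y + 1) ≤ Real.log (a + 1) + Real.log (y + 1) := by
    rw [← Real.log_mul (by linarith) (by linarith)]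
    exact Real.log_le_log (by positivity) (by nlinarith)
  have h2 : y ≤ 2 + y * Real.log (y + 1) := by
    rcases le_total y 2 with h | h
    · have := mul_nonneg hy hY
      linarith
    · have : 1 ≤ Real.log (y + 1) := by
        rw [Real.le_log_iff_exp_le (by linarith)]
        linarith [Real.exp_one_lt_three]
      nlinarith
  nlinarith [mul_le_mul_of_nonneg_left h1 hy, mul_le_mul_of_nonneg_left h2 hA]

theorem logMoment_le (X : ℕ → Ω → ℝ) (P : Measure Ω) [IsProbabilityMeasure P] (q : ℝ) {a : ℝ}
    (ha : 0 ≤ a) :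
    logMoment X P q a ≤ ENNReal.ofReal (2 * Real.log (a + 1)) +
      ENNReal.ofReal (Real.log (a + 1) + 1) * logMoment X P q 1 := by
  have hA : 0 ≤ Real.log (a + 1) := Real.log_nonneg (by linarith)
  calc logMoment X P q a
      ≤ ∫⁻ ω, (ENNReal.ofReal (2 * Real.log (a + 1)) + ENNReal.ofReal (Real.log (a + 1) + 1) *
          ENNReal.ofReal (|X 0 ω| ^ q * Real.log (1 * |X 0 ω| ^ q + 1))) ∂P := by
        refine lintegral_mono fun ω => ?_
        have hy : 0 ≤ |X 0 ω| ^ q := by positivity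
        have hlog : 0 ≤ Real.log (1 * |X 0 ω| ^ q + 1) := Real.log_nonneg (by linarith)
        dsimp only
        rw [← ENNReal.ofReal_mul (by positivity),
          ← ENNReal.ofReal_add (by positivity) (by positivity)]
        exact ENNReal.ofReal_le_ofReal (mul_log_mul_add_one_le ha hy)
    _ = _ := by
        rw [lintegral_add_left measurable_const, lintegral_const, measure_univ, mul_one,
          lintegral_const_mul' _ _ ENNReal.ofReal_ne_top, logMoment]

theorem iSup_tailSeries_lt_top {X : ℕ → Ω → ℝ} (hX : ∀ n, Measurable (X n)) {q : ℝ}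
    (hq : 1 ≤ q) (hq2 : q < 2) {Q : Set (Measure Ω)} (hQ : Q ⊆ centeredIIDLaws X)
    (hK : (⨆ P ∈ Q, logMoment X P q 1) < ∞) {ε : ℝ} (hε : 0 < ε) :
    (⨆ P ∈ Q, tailSeries X P q ε) < ∞ := by
  set K := ⨆ P ∈ Q, logMoment X P q 1
  have hD : 0 < (2 - q) * min (ε ^ 2) 1 :=
    mul_pos (by linarith) (lt_min (by positivity) one_pos)
  refine (iSup₂_le fun P hP => ?_ : _ ≤
    ENNReal.ofReal (1 + cConst q / (Real.exp 1 * Real.log ((2 : ℝ) ^ (1 / q - 1 / 2)))) +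
    2603 * (ENNReal.ofReal (2 * Real.log (38 / ε ^ q + 1)) +
      ENNReal.ofReal (Real.log (38 / ε ^ q + 1) + 1) * K) /
        ENNReal.ofReal ((2 - q) * min (ε ^ 2) 1)).trans_lt ?_
  · have := (hQ hP).1
    refine (tailSeries_le hX (hQ hP) hq hq2 hε).trans ?_
    gcongr
    refine (logMoment_le X P q (by positivity)).trans ?_
    gcongr
    exact le_iSup₂ (f := fun P _ => logMoment X P q 1) P hP
  · refine ENNReal.add_lt_top.2 ⟨ENNReal.ofReal_lt_top, ENNReal.div_lt_top ?_
      (ENNReal.ofReal_pos.2 hD).ne'⟩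
    exact ENNReal.mul_ne_top (by simp) (ENNReal.add_ne_top.2
      ⟨ENNReal.ofReal_ne_top, ENNReal.mul_ne_top ENNReal.ofReal_ne_top hK.ne⟩)

end BaumKatz

theorem mainTheorem6 {Ω : Type*} [MeasurableSpace Ω] (X : ℕ → Ω → ℝ)
    (hX : ∀ n, Measurable (X n)) (q : ℝ) (hq1 : 1 ≤ q) (hq2 : q < 2) :
    (∀ P ∈ BaumKatz.centeredIIDLaws X, ∀ ε : ℝ, 0 < ε →
      BaumKatz.tailSeries X P q ε ≤
        ENNReal.ofReal
          (1 + BaumKatz.cConst q / (Real.exp 1 * Real.log ((2 : ℝ) ^ (1 / q - 1 / 2))))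
        + 2603 * BaumKatz.logMoment X P q (38 / ε ^ q)
          / ENNReal.ofReal ((2 - q) * min (ε ^ 2) 1)) ∧
    (∀ Q : Set (Measure Ω), Q ⊆ BaumKatz.centeredIIDLaws X →
      (⨆ P ∈ Q, BaumKatz.logMoment X P q 1) < ∞ →
      ∀ ε : ℝ, 0 < ε → (⨆ P ∈ Q, BaumKatz.tailSeries X P q ε) < ∞) :=
  ⟨fun _ hP _ hε => BaumKatz.tailSeries_le hX hP hq1 hq2 hε,
    fun _ hQ hK _ hε => BaumKatz.iSup_tailSeries_lt_top hX hq1 hq2 hQ hK hε⟩
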